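/- Let $E$ be a finite group, let $F$ be a free group (of arbitrary rank), and let $1\to N\to F\to E\to 1$ be an exact sequence of groups, i.e. a presentation of $E$. Let $$M(E)=\big(N\cap[F,F]\big)/[F,N]$$ be the Schur multiplier of $E$, computed from this presentation. Then $M(E)$ is finite and $$|M(E)|\le |E|^{\log|E|},$$ where $\log$ is the natural logarithm. -/

import Mathlib

/-- The Schur multiplier of a group `E` computed from a presentation `φ : F → E` (a surjection from
a free group) with kernel `N`: the quotient `(N ∩ [F, F]) / [F, N]`. -/
def SchurMultiplier {F E : Type*} [Group F] [Group E] (φ : F →* E) : Type _ :=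
  (φ.ker ⊓ ⁅(⊤ : Subgroup F), (⊤ : Subgroup F)⁆ : Subgroup F) ⧸
    (⁅(⊤ : Subgroup F), φ.ker⁆.subgroupOf (φ.ker ⊓ ⁅(⊤ : Subgroup F), (⊤ : Subgroup F)⁆))

/-- The subgroup that is factored out in `SchurMultiplier` is contained in `N ∩ [F, F]`, so that
passing to `Subgroup.subgroupOf` loses nothing. -/
theorem commutator_top_ker_le {F E : Type*} [Group F] [Group E] (φ : F →* E) :
    ⁅(⊤ : Subgroup F), φ.ker⁆ ≤ φ.ker ⊓ ⁅(⊤ : Subgroup F), (⊤ : Subgroup F)⁆ :=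
  le_inf (Subgroup.commutator_le_right _ _) (Subgroup.commutator_mono le_rfl le_top)

/-- The Schur multiplier is an abelian group. -/
instance SchurMultiplier.instCommGroup {F E : Type*} [Group F] [Group E] (φ : F →* E) :
    CommGroup (SchurMultiplier φ) :=
  { (inferInstance : Group
      ((φ.ker ⊓ ⁅(⊤ : Subgroup F), (⊤ : Subgroup F)⁆ : Subgroup F) ⧸
        (⁅(⊤ : Subgroup F), φ.ker⁆.subgroupOf
          (φ.ker ⊓ ⁅(⊤ : Subgroup F), (⊤ : Subgroup F)⁆)))) with
    mul_comm := by
      intro a b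
      induction a using QuotientGroup.induction_on with
      | H x =>
        induction b using QuotientGroup.induction_on with
        | H y =>
          refine QuotientGroup.eq.2 ?_
          rw [Subgroup.mem_subgroupOf]
          simpa [commutatorElement_def, mul_assoc] using
            Subgroup.commutator_mem_commutator (H₁ := (⊤ : Subgroup F)) (H₂ := φ.ker)
              (g₁ := (y : F)⁻¹) (g₂ := (x : F)⁻¹) trivial (inv_mem x.2.1) }

/-! Put `G = F / [F, N]` and `A = N / [F, N]`, a central subgroup of index `|E|`; the multiplier
embeds in `A ∩ [G, G]`, finite by Schur. Fix `p`, let `p ^ v` be the `p`-part of `|E|`, and let `S`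
be the preimage in `G` of a Sylow `p`-subgroup of `G / A`. As `S` has index prime to `p`, the
transfer puts the `p`-part of `A ∩ [G, G]` inside `[S, S]`, whose order Wiegold's bound limits to `p
^ (v (v - 1) / 2)`. Summing over `p`, the logarithm is at most `∑ (v log p) ^ 2 ≤ (∑ v log p) ^ 2 =
(log |E|) ^ 2`. -/

open scoped commutatorElement

open Subgroup in
/-- Schur: a group with a central subgroup of finite index has finite commutator subgroup. -/
theorem finite_commutator_of_le_center {G : Type*} [Group G] (A : Subgroup G)
    (hA : A ≤ center G) [A.FiniteIndex] : Finite (commutator G) := by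
  have hfin : (commutatorSet G).Finite := by
    -- A commutator depends only on the cosets of its entries modulo the central `A`.
    refine (Set.finite_range fun q : (G ⧸ A) × (G ⧸ A) => ⁅q.1.out, q.2.out⁆).subset ?_
    rintro _ ⟨x, y, rfl⟩
    refine ⟨(x, y), ?_⟩
    obtain ⟨a, ha⟩ := QuotientGroup.mk_out_eq_mul A x
    obtain ⟨b, hb⟩ := QuotientGroup.mk_out_eq_mul A y
    have ha' := mem_center_iff.1 (hA a.2)
    have hb' := mem_center_iff.1 (hA b.2)
    simp only [ha, hb, commutatorElement_def, mul_inv_rev]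
    calc x * a * (y * b) * ((a : G)⁻¹ * x⁻¹) * ((b : G)⁻¹ * y⁻¹)
        = x * (a * (y * b)) * (a : G)⁻¹ * x⁻¹ * (b : G)⁻¹ * y⁻¹ := by group
      _ = x * y * (b * x⁻¹) * (b : G)⁻¹ * y⁻¹ := by rw [← ha' (y * b)]; group
      _ = x * y * x⁻¹ * y⁻¹ := by rw [← hb' x⁻¹]; group
  have := hfin.to_subtype
  infer_instance

open Subgroup in
/-- The homomorphism `g ↦ ⁅z, g⁆`, for an element `z` all of whose commutators are central. -/
def commutatorHom {G : Type*} [Group G] (z : G) (hz : ∀ g, ⁅z, g⁆ ∈ center G) : G →* G where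
  toFun g := ⁅z, g⁆
  map_one' := commutatorElement_one_right z
  map_mul' g h := by
    calc ⁅z, g * h⁆ = ⁅z, g⁆ * (g * ⁅z, h⁆) * g⁻¹ := by simp only [commutatorElement_def]; group
      _ = ⁅z, g⁆ * ⁅z, h⁆ := by rw [mem_center_iff.1 (hz h) g]; group

open Subgroup in
/-- Wiegold: if `G` has a central subgroup of index `p ^ n`, then its commutator subgroup has order
at most `p ^ (n * (n - 1) / 2)`. -/
theorem card_commutator_le_of_index_eq_prime_pow {p : ℕ} [hp : Fact p.Prime] (n : ℕ) :
    ∀ {G : Type*} [Group G] (A : Subgroup G), A ≤ center G → A.index = p ^ n →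
      Nat.card (commutator G) ≤ p ^ (n * (n - 1) / 2) := by
  induction n using Nat.strong_induction_on with
  | _ n ih =>
  intro G _ A hA hn
  have hA0 : A.FiniteIndex := ⟨by rw [hn]; exact pow_ne_zero _ hp.out.ne_zero⟩
  have hAn : A.Normal := ⟨fun a ha g => by
    rw [mem_center_iff.1 (hA ha) g, mul_inv_cancel_right]; exact ha⟩
  have hcard : Nat.card (G ⧸ A) = p ^ n := hn
  rcases Nat.eq_zero_or_pos n with rfl | hpos
  · have hc : center G = ⊤ := top_le_iff.1 ((index_eq_one.1 (by simpa using hn)).ge.trans hA)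
    have : commutator G = ⊥ := (commutator_eq_bot_iff_center_eq_top G).2 hc
    simp [this]
  have hfin : Finite (G ⧸ A) := inferInstance
  have hnt : Nontrivial (G ⧸ A) := Finite.one_lt_card_iff_nontrivial.1
    (by rw [hcard]; exact Nat.one_lt_pow hpos.ne' hp.out.one_lt)
  have hcnt := (IsPGroup.of_card hcard).center_nontrivial
  -- Induct by dividing out the image of `g ↦ ⁅z, g⁆`, for `z` outside `A` and central modulo `A`:
  -- then `z` becomes central and joins `A`, which lowers the index.
  obtain ⟨⟨w, hw⟩, hw1⟩ := exists_ne (1 : center (G ⧸ A))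
  obtain ⟨z, rfl⟩ := QuotientGroup.mk_surjective w
  have hzA : z ∉ A := fun h => hw1 (Subtype.ext ((QuotientGroup.eq_one_iff z).2 h))
  have hz : ∀ g, ⁅z, g⁆ ∈ A := fun g => by
    rw [← QuotientGroup.eq_one_iff]
    change ((QuotientGroup.mk' A) ⁅z, g⁆) = 1
    rw [map_commutatorElement, commutatorElement_eq_one_iff_mul_comm]
    exact (mem_center_iff.1 hw _).symm
  set f := commutatorHom z fun g => hA (hz g) with hf
  have hBA : f.range ≤ A := by rintro _ ⟨g, rfl⟩; exact hz g
  have hBn : f.range.Normal := ⟨fun a ha g => by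
    rw [mem_center_iff.1 (hA (hBA ha)) g, mul_inv_cancel_right]; exact ha⟩
  have hBc : f.range ≤ commutator G := by
    rintro _ ⟨g, rfl⟩; exact commutator_mem_commutator (mem_top _) (mem_top _)
  set A' := A ⊔ zpowers z with hA'
  have hAA' : A ≤ A' := le_sup_left
  have hzA' : z ∈ A' := (le_sup_right : zpowers z ≤ A') (mem_zpowers z)
  have hmul := relIndex_mul_index hAA'
  obtain ⟨m, -, hm⟩ := (Nat.dvd_prime_pow hp.out).1 (hn ▸ Dvd.intro_left _ hmul)
  have hlt : m < n := by
    rw [← Nat.pow_lt_pow_iff_right hp.out.one_lt, ← hm, ← hn]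
    refine lt_of_le_of_ne (Nat.le_of_dvd (Nat.pos_of_ne_zero hA0.1) (Dvd.intro_left _ hmul)) ?_
    intro h
    rw [← h] at hmul
    have h0 : A'.index ≠ 0 := h ▸ hA0.1
    have h1 : A.relIndex A' = 1 := by
      simpa [h0] using hmul
    exact hzA (relIndex_eq_one.1 h1 hzA')
  have hker : A' ≤ f.ker := by
    refine sup_le (fun a ha => ?_) ((zpowers_le).2 ?_)
    · exact commutatorElement_eq_one_iff_mul_comm.2 (mem_center_iff.1 (hA ha) z)
    · exact commutatorElement_self z
  have hBcard : Nat.card f.range ≤ p ^ m := by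
    rw [← index_ker, ← hm]
    exact Nat.le_of_dvd (Nat.pos_of_ne_zero (hm ▸ pow_ne_zero _ hp.out.ne_zero))
      (index_dvd_of_le hker)
  have hcen : A'.map (QuotientGroup.mk' f.range) ≤ center (G ⧸ f.range) := by
    rw [map_le_iff_le_comap]
    refine sup_le (fun a ha => ?_) ((zpowers_le).2 ?_) <;> rw [mem_comap, mem_center_iff] <;>
      intro g <;> obtain ⟨g, rfl⟩ := QuotientGroup.mk'_surjective _ g
    · rw [← map_mul, mem_center_iff.1 (hA ha) g, map_mul]
    · symm
      rw [← commutatorElement_eq_one_iff_mul_comm, ← map_commutatorElement]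
      exact (QuotientGroup.eq_one_iff _).2 ⟨g, rfl⟩
  have hidx : (A'.map (QuotientGroup.mk' f.range)).index = p ^ m := by
    rw [← hm]
    exact index_map_eq _ (QuotientGroup.mk'_surjective _)
      (by rw [QuotientGroup.ker_mk']; exact hBA.trans hAA')
  have hrec := ih m hlt _ hcen hidx
  have hmap : commutator (G ⧸ f.range) = (commutator G).map (QuotientGroup.mk' f.range) := by
    rw [commutator_def, commutator_def, map_commutator,
      map_top_of_surjective _ (QuotientGroup.mk'_surjective _)]
  have hprod : Nat.card f.range * Nat.card (commutator (G ⧸ f.range)) = Nat.card (commutator G) := by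
    rw [hmap, ← relIndex_ker, QuotientGroup.ker_mk', ← relIndex_bot_left, ← relIndex_bot_left]
    exact relIndex_mul_relIndex _ _ _ bot_le hBc
  rw [← hprod]
  -- The exponents add up to `(m + 1) m / 2`, and `m + 1 ≤ n`.
  calc _ ≤ p ^ m * p ^ (m * (m - 1) / 2) := Nat.mul_le_mul hBcard hrec
    _ = p ^ ((m + 1) * (m + 1 - 1) / 2) := by
        rw [← pow_add, Nat.triangle_succ, add_comm]
    _ ≤ p ^ (n * (n - 1) / 2) := by
        refine Nat.pow_le_pow_right hp.out.pos (Nat.div_le_div_right ?_)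
        exact Nat.mul_le_mul hlt (Nat.sub_le_sub_right hlt 1)

open Subgroup in
/-- The transfer to a subgroup `S` of finite index raises a central element to the power `S.index`,
so this power of a central element of `[G, G]` lies in `[S, S]`. -/
theorem pow_index_mem_map_commutator {G : Type*} [Group G] (S : Subgroup G) [S.FiniteIndex] {a : G}
    (ha : a ∈ center G) (ha' : a ∈ commutator G) :
    a ^ S.index ∈ (commutator S).map S.subtype := by
  have h := MonoidHom.transfer_eq_pow (Abelianization.of (G := S)) a fun k g _ => by
    rw [mul_assoc, ← mem_center_iff.1 (pow_mem ha k) g, inv_mul_cancel_left]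
  -- The transfer has an abelian target, so it kills `a`.
  rw [MonoidHom.mem_ker.1 (Abelianization.commutator_subset_ker _ ha')] at h
  have hmem := MonoidHom.mem_ker.2 h.symm
  rw [Abelianization.ker_of] at hmem
  exact ⟨_, hmem, rfl⟩

open Subgroup in
/-- The `p`-part of `A ∩ [G, G]`, for `A` central of finite index. -/
theorem factorization_card_inf_commutator_le {G : Type*} [Group G] (A : Subgroup G)
    (hA : A ≤ center G) [A.FiniteIndex] (p : ℕ) [hp : Fact p.Prime] :
    (Nat.card (A ⊓ commutator G : Subgroup G)).factorization p ≤
      A.index.factorization p * (A.index.factorization p - 1) / 2 := by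
  have hAn : A.Normal := ⟨fun a ha g => by
    rw [mem_center_iff.1 (hA ha) g, mul_inv_cancel_right]; exact ha⟩
  have := finite_commutator_of_le_center A hA
  have hM : Finite (A ⊓ commutator G : Subgroup G) :=
    Finite.of_injective _ (inclusion_injective (inf_le_right : A ⊓ commutator G ≤ _))
  obtain ⟨K, hK⟩ := Sylow.exists_subgroup_card_pow_prime (G := (A ⊓ commutator G : Subgroup G)) p
    (Nat.ordProj_dvd _ p)
  let Q : Sylow p (G ⧸ A) := default
  set S : Subgroup G := (Q : Subgroup (G ⧸ A)).comap (QuotientGroup.mk' A) with hS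
  have hSi : S.index = (Q : Subgroup (G ⧸ A)).index :=
    index_comap_of_surjective _ (QuotientGroup.mk'_surjective A)
  have hSfin : S.FiniteIndex := ⟨hSi ▸ FiniteIndex.index_ne_zero⟩
  have hcop : ¬ p ∣ S.index := hSi ▸ Q.not_dvd_index
  have hrel : (A.subgroupOf S).index = p ^ A.index.factorization p := by
    change A.relIndex S = _
    conv_lhs => rw [← QuotientGroup.ker_mk' A]
    rw [relIndex_ker, hS, map_comap_eq_self_of_surjective (QuotientGroup.mk'_surjective A)]
    exact Q.card_eq_multiplicity
  have hcen : A.subgroupOf S ≤ center S := fun a ha =>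
    mem_center_iff.2 fun g => Subtype.ext (mem_center_iff.1 (hA ha) g)
  have hbound := card_commutator_le_of_index_eq_prime_pow _ _ hcen hrel
  have hAS : (A.subgroupOf S).FiniteIndex :=
    ⟨by rw [hrel]; exact pow_ne_zero _ hp.out.ne_zero⟩
  have hSc := finite_commutator_of_le_center _ hcen
  have hle : K.map (A ⊓ commutator G).subtype ≤ (commutator S).map S.subtype := by
    rintro _ ⟨a, ha, rfl⟩
    have h1 := pow_index_mem_map_commutator S (hA a.2.1) a.2.2
    have h2 : (a : G) ^ p ^ (Nat.card (A ⊓ commutator G : Subgroup G)).factorization p = 1 := by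
      have := pow_card_eq_one' (x := (⟨a, ha⟩ : K))
      rw [hK] at this
      simpa using congrArg (fun x : K => ((x : (A ⊓ commutator G : Subgroup G)) : G)) this
    have hco := Nat.Coprime.pow_left
      ((Nat.card (A ⊓ commutator G : Subgroup G)).factorization p)
      ((Nat.Prime.coprime_iff_not_dvd hp.out).2 hcop)
    rw [← zpowers_le] at h1
    refine h1 ?_
    -- The order of `a` is a power of `p`, so `a` is itself a power of `a ^ S.index`.
    obtain ⟨b, hb⟩ := exists_pow_eq_self_of_coprime (x := (a : G)) (n := S.index)
      (hco.symm.coprime_dvd_right (orderOf_dvd_of_pow_eq_one h2))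
    exact ⟨b, by simpa using hb⟩
  have : Finite ((commutator S).map S.subtype) :=
    Set.Finite.image S.subtype (Set.toFinite (commutator S : Set S))
  have hcard := card_le_of_le hle
  rw [card_map_of_injective (subtype_injective _), card_map_of_injective (subtype_injective _),
    hK] at hcard
  exact (Nat.pow_le_pow_iff_right hp.out.one_lt).1 (hcard.trans hbound)

/-- If every `p`-adic valuation `k` of `m` is at most `v (v - 1) / 2`, where `v` is that of `n`, then
`m ≤ n ^ log n`. -/
theorem natCast_le_rpow_log_of_factorization_le {m n : ℕ} (hm : m ≠ 0) (hn : n ≠ 0)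
    (h : ∀ p, p.Prime → m.factorization p ≤ n.factorization p * (n.factorization p - 1) / 2) :
    (m : ℝ) ≤ (n : ℝ) ^ Real.log n := by
  have hm0 : (0 : ℝ) < m := by positivity
  have hn0 : (0 : ℝ) < n := by positivity
  rw [← Real.log_le_log_iff hm0 (Real.rpow_pos_of_pos hn0 _), Real.log_rpow hn0]
  have hsub : m.factorization.support ⊆ n.factorization.support := fun p hp => by
    rw [Finsupp.mem_support_iff] at hp ⊢
    intro h0
    have := h p (Nat.prime_of_mem_primeFactors (Finsupp.mem_support_iff.2 hp))
    rw [h0] at this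
    simp at this
    exact hp this
  have hterm : ∀ p ∈ n.factorization.support,
      (m.factorization p : ℝ) * Real.log p ≤ (n.factorization p * Real.log p) ^ 2 := by
    intro p hp
    have hpp : p.Prime := Nat.prime_of_mem_primeFactors hp
    -- The factor `1 / 2` in `hk` is traded for a second `log p`, which makes each term a square.
    have hlog : 1 / 2 ≤ Real.log p := by
      have := Real.log_le_log (by norm_num) (show (2 : ℝ) ≤ p by exact_mod_cast hpp.two_le)
      linarith [Real.log_two_gt_d9]
    have hk : (m.factorization p : ℝ) ≤ (n.factorization p : ℝ) ^ 2 / 2 := by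
      have h1 : 2 * m.factorization p ≤ n.factorization p * n.factorization p :=
        calc 2 * m.factorization p
            ≤ 2 * (n.factorization p * (n.factorization p - 1) / 2) :=
              Nat.mul_le_mul_left 2 (h p hpp)
          _ ≤ n.factorization p * (n.factorization p - 1) := Nat.mul_div_le _ _
          _ ≤ _ := Nat.mul_le_mul_left _ (Nat.sub_le _ _)
      have h2 : (2 : ℝ) * m.factorization p ≤ n.factorization p * n.factorization p := by
        exact_mod_cast h1
      linarith
    calc (m.factorization p : ℝ) * Real.log p
        ≤ (n.factorization p : ℝ) ^ 2 / 2 * Real.log p := by gcongr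
      _ = (n.factorization p : ℝ) ^ 2 * Real.log p * (1 / 2) := by ring
      _ ≤ (n.factorization p : ℝ) ^ 2 * Real.log p * Real.log p := by gcongr
      _ = _ := by ring
  have hnonneg : ∀ p ∈ n.factorization.support, (0 : ℝ) ≤ n.factorization p * Real.log p :=
    fun p _ => mul_nonneg (Nat.cast_nonneg _) (Real.log_natCast_nonneg p)
  calc Real.log m = ∑ p ∈ n.factorization.support, (m.factorization p : ℝ) * Real.log p := by
        rw [Real.log_nat_eq_sum_factorization, Finsupp.sum_of_support_subset _ hsub _ (by simp)]
    _ ≤ ∑ p ∈ n.factorization.support, (n.factorization p * Real.log p) ^ 2 :=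
        Finset.sum_le_sum hterm
    _ ≤ (∑ p ∈ n.factorization.support, n.factorization p * Real.log p) ^ 2 :=
        Finset.sum_sq_le_sq_sum_of_nonneg hnonneg
    _ = Real.log n * Real.log n := by
        rw [Real.log_nat_eq_sum_factorization n, Finsupp.sum, sq]

open Subgroup in
/-- For `φ` surjective with kernel `N`, the Schur multiplier embeds into `A ∩ [G, G]`, where
`G = F / [F, N]` and `A = N / [F, N]` is a central subgroup of `G` of index `|E|`. -/
theorem exists_schurMultiplier_injective {E F : Type*} [Group E] [Group F] (φ : F →* E)
    (hφ : Function.Surjective φ) :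
    ∃ A : Subgroup (F ⧸ ⁅(⊤ : Subgroup F), φ.ker⁆), A ≤ center _ ∧ A.index = Nat.card E ∧
      ∃ f : SchurMultiplier φ → (A ⊓ commutator _ : Subgroup _), Function.Injective f := by
  let ψ : F ⧸ ⁅(⊤ : Subgroup F), φ.ker⁆ →* E :=
    QuotientGroup.lift _ φ (commutator_le_right _ _)
  have hψ : Function.Surjective ψ := fun e => by
    obtain ⟨x, rfl⟩ := hφ e
    exact ⟨x, rfl⟩
  refine ⟨ψ.ker, fun a ha => mem_center_iff.2 fun g => ?_, ?_, ?_⟩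
  · obtain ⟨a, rfl⟩ := QuotientGroup.mk'_surjective _ a
    obtain ⟨g, rfl⟩ := QuotientGroup.mk'_surjective _ g
    rw [← commutatorElement_eq_one_iff_mul_comm, ← map_commutatorElement]
    exact (QuotientGroup.eq_one_iff _).2 (commutator_mem_commutator (mem_top g) ha)
  · rw [index_ker, MonoidHom.range_eq_top.2 hψ, card_top]
  · let g : (φ.ker ⊓ ⁅(⊤ : Subgroup F), (⊤ : Subgroup F)⁆ : Subgroup F) →*
        (ψ.ker ⊓ commutator _ : Subgroup _) :=
      ((QuotientGroup.mk' ⁅(⊤ : Subgroup F), φ.ker⁆).comp (Subgroup.subtype _)).codRestrict _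
        fun x => ⟨x.2.1, by
          have h := mem_map_of_mem (QuotientGroup.mk' ⁅(⊤ : Subgroup F), φ.ker⁆) x.2.2
          rw [map_commutator, map_top_of_surjective _ (QuotientGroup.mk'_surjective _)] at h
          exact h⟩
    have hg : g.ker = ⁅(⊤ : Subgroup F), φ.ker⁆.subgroupOf
        (φ.ker ⊓ ⁅(⊤ : Subgroup F), (⊤ : Subgroup F)⁆) := by
      ext x
      rw [MonoidHom.mem_ker, mem_subgroupOf, ← QuotientGroup.eq_one_iff, Subtype.ext_iff]
      rfl
    have := QuotientGroup.kerLift_injective g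
    rw [SchurMultiplier, ← hg]
    exact ⟨_, this⟩

theorem mainTheorem6 {E : Type*} [Group E] [Finite E] {F : Type*} [Group F] [IsFreeGroup F]
    (φ : F →* E) (hφ : Function.Surjective φ) :
    Finite (SchurMultiplier φ) ∧
      (Nat.card (SchurMultiplier φ) : ℝ) ≤ (Nat.card E : ℝ) ^ Real.log (Nat.card E : ℝ) := by
  obtain ⟨A, hA, hidx, f, hf⟩ := exists_schurMultiplier_injective φ hφ
  have hE : Nat.card E ≠ 0 := Nat.card_pos.ne'
  have hAfin : A.FiniteIndex := ⟨hidx ▸ hE⟩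
  have := finite_commutator_of_le_center A hA
  have hfin : Finite (A ⊓ commutator _ : Subgroup _) :=
    Finite.of_injective _ (Subgroup.inclusion_injective (inf_le_right : A ⊓ commutator _ ≤ _))
  refine ⟨Finite.of_injective f hf, ?_⟩
  calc (Nat.card (SchurMultiplier φ) : ℝ) ≤ Nat.card (A ⊓ commutator _ : Subgroup _) := by
        exact_mod_cast Nat.card_le_card_of_injective f hf
    _ ≤ _ := natCast_le_rpow_log_of_factorization_le Nat.card_pos.ne' hE fun p hp => by
        have : Fact p.Prime := ⟨hp⟩
        rw [← hidx]
        exact factorization_card_inf_commutator_le A hA p
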